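/- Let $\mathcal C\subseteq\mathbb F_2^n$ be a binary linear code, let $X=(X_1,\dots,X_n)$ be uniformly distributed on $\mathcal C$, and for $0\le\epsilon\le 1$ let $Y^\epsilon$ be the result of passing $X$ through the memoryless binary erasure channel with erasure probability $\epsilon$. Write $Y^\epsilon_{\sim i}$ for $(Y^\epsilon_k)_{k\ne i}$ and define the EXIT function, with entropies in bits, by $$g(\epsilon)=\frac1n\sum_{i=1}^n H(X_i\mid Y^\epsilon_{\sim i}).$$ For $i\neq j$ and $z\in\{0,1\}^n$, and for $s,t\in\{0,1\}$, let $\mathcal C^{ij}_{st}(z)$ be the set of codewords $c\in\mathcal C$ with $(c_i,c_j)=(s,t)$ whose support is contained in the support of $z$. Let \begin{align*} \mathcal B^{ij}_2&=\{z:\ \mathcal C^{ij}_{01}(z)\ne\emptyset,\ \mathcal C^{ij}_{10}(z)=\mathcal C^{ij}_{11}(z)=\emptyset\},\\ \mathcal B^{ij}_3&=\{z:\ \mathcal C^{ij}_{10}(z)\ne\emptyset,\ \mathcal C^{ij}_{01}(z)=\mathcal C^{ij}_{11}(z)=\emptyset\},\\ \mathcal B^{ij}_4&=\{z:\ \mathcal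 C^{ij}_{11}(z)\ne\emptyset,\ \mathcal C^{ij}_{01}(z)=\mathcal C^{ij}_{10}(z)=\emptyset\}, \end{align*} let $Z^\epsilon\in\{0,1\}^n$ be the random vector with $Z^\epsilon_i=Z^\epsilon_j=1$ and with the remaining coordinates independent Bernoulli($\epsilon$), and set $$\alpha^\epsilon_{ij}=\Pr\bigl(Z^\epsilon\in\mathcal B^{ij}_4\ \big|\ Z^\epsilon\in\mathcal B^{ij}_2\cup\mathcal B^{ij}_3\cup\mathcal B^{ij}_4\bigr)$$ (with the value $0$ if the conditioning event has probability $0$). There is a function $c$ of $\delta\in(0,\tfrac12]$ alone, bounded below by a positive constant on $[\delta_0,\tfrac12]$ for every $\delta_0>0$, such that the following holds for all $0<\delta\le\frac12$, all $n$, all $\epsilon\in[0,1]$ and all $1$-transitive binary linear codes $\mathcal C$ of length $n$ (that is, for all coordinates $i,j$ some permutation of the coordinates that leaves $\mathcal C$ invariant maps $i$ to $j$): if $g(\epsilon)\in(\delta,1-\delta)$, then $g$, as a function on $[0,1]$, is differentiable at $\epsilon$ and $$g'(\epsilon)\ \ge\ \frac{c(\delta)}{n^{3/2}}\sum_{i=1}^n\sum_{j\ne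 i}\alpha^\epsilon_{ij}.$$ -/

import Mathlib

noncomputable section

namespace ExitBEC

open scoped BigOperators
open Classical in
/-- The probability that the random variable `f`, defined on a finite sample space with
probability mass function `p`, takes the value `a`. -/
def lawOf {Ω α : Type*} [Fintype Ω] (p : Ω → ℝ) (f : Ω → α) (a : α) : ℝ :=
  ∑ ω, if f ω = a then p ω else 0

/-- The conditional Shannon entropy `H(U | V)`, in bits, of random variables `U`, `V` on a finite
sample space with probability mass function `p`:
`H(U | V) = - ∑ u, v, P(U = u, V = v) log₂ P(U = u | V = v)`.
Terms with `P(U = u, V = v) = 0` contribute `0`. -/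
def condEntropy {Ω α β : Type*} [Fintype Ω] [Fintype α] [Fintype β]
    (p : Ω → ℝ) (U : Ω → α) (V : Ω → β) : ℝ :=
  -∑ u : α, ∑ v : β, lawOf p (fun ω => (U ω, V ω)) (u, v) *
      Real.logb 2 (lawOf p (fun ω => (U ω, V ω)) (u, v) / lawOf p V v)

/-- Binary words of length `n`. -/
abbrev Word (n : ℕ) : Type := Fin n → ZMod 2

/-- Channel outputs of length `n`; `none` is the erasure symbol `?`. -/
abbrev Output (n : ℕ) : Type := Fin n → Option (ZMod 2)

/-- Binary linear codes of length `n`. -/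
abbrev LinearCode (n : ℕ) : Type := Submodule (ZMod 2) (Word n)

/-- The code `C` is `1`-transitive: for all coordinates `i`, `j` there is a permutation of the
coordinates that maps `i` to `j` and leaves `C` invariant. -/
def OneTransitive {n : ℕ} (C : LinearCode n) : Prop :=
  ∀ i j : Fin n, ∃ π : Equiv.Perm (Fin n), π i = j ∧ ∀ x : Word n, x ∘ π ∈ C ↔ x ∈ C

/-- The transition probability `W(y | x)` of the binary erasure channel with erasure
probability `ε`. -/
def becKernel (ε : ℝ) (x : ZMod 2) : Option (ZMod 2) → ℝ
  | none => ε
  | some b => if b = x then 1 - ε else 0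

open Classical in
/-- The joint probability mass function of `(X, Y^ε)`: `X` is uniform on the code `C`, and `Y^ε` is
the result of passing `X` through `n` independent uses of the BEC with parameter `ε`. -/
def jointPMF {n : ℕ} (C : LinearCode n) (ε : ℝ) (ω : Word n × Output n) : ℝ :=
  (if ω.1 ∈ C then (Nat.card C : ℝ)⁻¹ else 0) * ∏ k, becKernel ε (ω.1 k) (ω.2 k)

/-- `H(X_i | Y^ε_{∼i})`, where `Y^ε_{∼i}` collects all the outputs except the `i`-th. -/
def bitEntropy {n : ℕ} (C : LinearCode n) (ε : ℝ) (i : Fin n) : ℝ :=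
  condEntropy (jointPMF C ε) (fun ω => ω.1 i) (fun ω => fun k : {k : Fin n // k ≠ i} => ω.2 k)

/-- The EXIT function `g(ε) = (1/n) ∑ i, H(X_i | Y^ε_{∼i})` (of interest for `ε ∈ [0, 1]`). -/
def exitFunction {n : ℕ} (C : LinearCode n) (ε : ℝ) : ℝ :=
  (1 / (n : ℝ)) * ∑ i : Fin n, bitEntropy C ε i

/-- `z` covers `a`: the support of `a` is contained in the support of `z`. -/
def Covers {n : ℕ} (z a : Word n) : Prop := ∀ k, a k = 1 → z k = 1

/-- `z` covers some codeword `c ∈ C` with `(c_i, c_j) = (s, t)`, that is, `C^{ij}_{st}(z) ≠ ∅`. -/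
def CoversSome {n : ℕ} (C : LinearCode n) (i j : Fin n) (s t : ZMod 2) (z : Word n) : Prop :=
  ∃ c ∈ C, c i = s ∧ c j = t ∧ Covers z c

/-- The set `B₂^{ij}`. -/
def B2 {n : ℕ} (C : LinearCode n) (i j : Fin n) : Set (Word n) :=
  {z | CoversSome C i j 0 1 z ∧ ¬ CoversSome C i j 1 0 z ∧ ¬ CoversSome C i j 1 1 z}

/-- The set `B₃^{ij}`. -/
def B3 {n : ℕ} (C : LinearCode n) (i j : Fin n) : Set (Word n) :=
  {z | CoversSome C i j 1 0 z ∧ ¬ CoversSome C i j 0 1 z ∧ ¬ CoversSome C i j 1 1 z}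

/-- The set `B₄^{ij}`. -/
def B4 {n : ℕ} (C : LinearCode n) (i j : Fin n) : Set (Word n) :=
  {z | CoversSome C i j 1 1 z ∧ ¬ CoversSome C i j 0 1 z ∧ ¬ CoversSome C i j 1 0 z}

open Classical in
/-- The probability mass function of the random erasure pattern `Z^ε(ij)`: the coordinates `i` and
`j` equal `1`, all the others are independent Bernoulli(`ε`). -/
def patternPMF {n : ℕ} (ε : ℝ) (i j : Fin n) (z : Word n) : ℝ :=
  ∏ k, if k = i ∨ k = j then (if z k = 1 then 1 else 0) else (if z k = 1 then ε else 1 - ε)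

open Classical in
/-- `Pr(Z^ε(ij) ∈ A)`. -/
def patternProb {n : ℕ} (ε : ℝ) (i j : Fin n) (A : Set (Word n)) : ℝ :=
  ∑ z, if z ∈ A then patternPMF ε i j z else 0

/-- `α_{ij}^ε = Pr(Z^ε ∈ B₄ | Z^ε ∈ B₂ ∪ B₃ ∪ B₄)` (with value `0` if the conditioning event has
probability `0`). -/
def alpha {n : ℕ} (C : LinearCode n) (ε : ℝ) (i j : Fin n) : ℝ :=
  patternProb ε i j (B4 C i j) / patternProb ε i j (B2 C i j ∪ B3 C i j ∪ B4 C i j)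

end ExitBEC

end

noncomputable section

namespace ExitBEC

/-! The entropy of bit `i` given the other outputs is the probability that an i.i.d. erasure pattern
leaves the bit undetermined (`bitEntropy_eq`); by transitivity this is `g(ε)` for every `i`. The
event is increasing, and coordinate `j` is pivotal for it exactly when the pattern with `i` and `j`
forced to `1` lies in `B4` (`pivotal_iff`). Russo's formula thus gives `g' = (1/n) ∑ P(B4)`, where
`P(B4) = α · P(B2 ∪ B3 ∪ B4)`. It remains to bound `P(B2 ∪ B3 ∪ B4)` below by a multiple of `1/√n`.

The pairs `(c i, c j)` of covered codewords form a subspace of `F₂²`, and `B2 ∪ B3 ∪ B4` is the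
event that its dimension is one. It contains the inner vertex boundary of the increasing event
"dimension at least one" (`rankOne_of_boundary`), so `isoperimetric_increasing` applies unless that
event has probability near `1`. In that case, since dimension two forces `i` to be undetermined and
`g < 1 - δ`, the dimension-one event already has probability of order `δ` (`rankOne_lower_bound`).
-/

open Function

/-! ### Product measures on the cube and Russo's formula -/

/-- The weight of the bit `b` under the Bernoulli distribution with parameter `p`. -/
def bernoulliWeight (p : ℝ) (b : ZMod 2) : ℝ := if b = 1 then p else 1 - p

/-- The expectation of `f` under independent bits with parameters `q k`. -/
def productExp {n : ℕ} (q : Fin n → ℝ) (f : Word n → ℝ) : ℝ :=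
  ∑ z, f z * ∏ k, bernoulliWeight (q k) (z k)

/-- The probability of `A` under independent bits with parameters `q k`. -/
def productProb {n : ℕ} (q : Fin n → ℝ) (A : Set (Word n)) : ℝ :=
  productExp q (A.indicator 1)

lemma zmod_two_sum (f : ZMod 2 → ℝ) : ∑ b, f b = f 0 + f 1 := Fin.sum_univ_two f

lemma zmod_two_eq_zero {b : ZMod 2} (h : b ≠ 1) : b = 0 := by
  revert b; decide

@[simp] lemma bernoulliWeight_one (p : ℝ) : bernoulliWeight p 1 = p := by
  simp [bernoulliWeight]

@[simp] lemma bernoulliWeight_zero (p : ℝ) : bernoulliWeight p 0 = 1 - p := by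
  simp [bernoulliWeight]

lemma bernoulliWeight_nonneg {p : ℝ} (hp : p ∈ Set.Icc (0 : ℝ) 1) (b : ZMod 2) :
    0 ≤ bernoulliWeight p b := by
  unfold bernoulliWeight
  split_ifs
  · exact hp.1
  · linarith [hp.2]

lemma productExp_add {n : ℕ} (q : Fin n → ℝ) (f g : Word n → ℝ) :
    productExp q (fun z => f z + g z) = productExp q f + productExp q g := by
  simp [productExp, add_mul, Finset.sum_add_distrib]

lemma productExp_sub {n : ℕ} (q : Fin n → ℝ) (f g : Word n → ℝ) :
    productExp q (fun z => f z - g z) = productExp q f - productExp q g := by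
  simp [productExp, sub_mul, Finset.sum_sub_distrib]

lemma productExp_mono {n : ℕ} {q : Fin n → ℝ} (hq : ∀ k, q k ∈ Set.Icc (0 : ℝ) 1)
    {f g : Word n → ℝ} (h : ∀ z, f z ≤ g z) : productExp q f ≤ productExp q g :=
  Finset.sum_le_sum fun z _ => mul_le_mul_of_nonneg_right (h z)
    (Finset.prod_nonneg fun k _ => bernoulliWeight_nonneg (hq k) _)

lemma productExp_one {n : ℕ} (q : Fin n → ℝ) : productExp q 1 = 1 := by
  have h := Fintype.prod_sum (fun k (b : ZMod 2) => bernoulliWeight (q k) b)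
  simp only [zmod_two_sum, bernoulliWeight_zero, bernoulliWeight_one, sub_add_cancel,
    Finset.prod_const_one] at h
  simp [productExp, ← h]

lemma productProb_mono {n : ℕ} {q : Fin n → ℝ} (hq : ∀ k, q k ∈ Set.Icc (0 : ℝ) 1)
    {A B : Set (Word n)} (h : A ⊆ B) : productProb q A ≤ productProb q B :=
  productExp_mono hq fun z => Set.indicator_le_indicator_of_subset h (by simp) z

lemma productProb_nonneg {n : ℕ} {q : Fin n → ℝ} (hq : ∀ k, q k ∈ Set.Icc (0 : ℝ) 1)
    (A : Set (Word n)) : 0 ≤ productProb q A := by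
  have := productProb_mono hq (Set.empty_subset A)
  simpa [productProb, productExp] using this

lemma productProb_le_one {n : ℕ} {q : Fin n → ℝ} (hq : ∀ k, q k ∈ Set.Icc (0 : ℝ) 1)
    (A : Set (Word n)) : productProb q A ≤ 1 := by
  rw [← productExp_one q]
  exact productExp_mono hq fun z => Set.indicator_le_self' (by simp) z

lemma productExp_insertNth {n : ℕ} (q : Fin (n + 1) → ℝ) (j : Fin (n + 1))
    (f : Word (n + 1) → ℝ) :
    productExp q f =
      (1 - q j) * productExp (fun k => q (j.succAbove k))
          (fun w => f (j.insertNth (α := fun _ => ZMod 2) 0 w)) +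
        q j * productExp (fun k => q (j.succAbove k))
          (fun w => f (j.insertNth (α := fun _ => ZMod 2) 1 w)) := by
  unfold productExp
  rw [← (Fin.insertNthEquiv (fun _ => ZMod 2) j).sum_comp, Fintype.sum_prod_type, zmod_two_sum,
    Finset.mul_sum, Finset.mul_sum]
  have ins (b : ZMod 2) (w : Word n) : Fin.insertNthEquiv (fun _ => ZMod 2) j (b, w) =
      j.insertNth (α := fun _ => ZMod 2) b w := rfl
  simp only [ins, Fin.prod_univ_succAbove _ j, Fin.insertNth_apply_same,
    Fin.insertNth_apply_succAbove, bernoulliWeight_zero, bernoulliWeight_one]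
  congr 1 <;> exact Finset.sum_congr rfl fun w _ => by ring

lemma productExp_update_one {n : ℕ} (q : Fin n → ℝ) (j : Fin n) (f : Word n → ℝ) :
    productExp (update q j 1) f = productExp q (fun z => f (update z j 1)) := by
  obtain _ | n := n
  · exact j.elim0
  · rw [productExp_insertNth _ j, productExp_insertNth _ j]
    simp [Fin.update_insertNth]
    ring

lemma productExp_update_zero {n : ℕ} (q : Fin n → ℝ) (j : Fin n) (f : Word n → ℝ) :
    productExp (update q j 0) f = productExp q (fun z => f (update z j 0)) := by
  obtain _ | n := n
  · exact j.elim0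
  · rw [productExp_insertNth _ j, productExp_insertNth _ j]
    simp [Fin.update_insertNth]
    ring

lemma hasDerivAt_bernoulliWeight (b : ZMod 2) (x : ℝ) :
    HasDerivAt (fun x => bernoulliWeight x b) (bernoulliWeight 1 b - bernoulliWeight 0 b) x := by
  unfold bernoulliWeight
  split_ifs
  · simpa using hasDerivAt_id' x
  · simpa using (hasDerivAt_id' x).const_sub 1

/-- The Margulis-Russo formula. -/
lemma hasDerivAt_productExp {n : ℕ} (f : Word n → ℝ) (x : ℝ) :
    HasDerivAt (fun x => productExp (fun _ => x) f)
      (∑ j, productExp (fun _ => x) (fun z => f (update z j 1) - f (update z j 0))) x := by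
  -- Each weight is affine in its parameter, so its derivative is the difference of its values at
  -- parameters `1` and `0`, that is, with the bit forced to `1` and to `0`.
  have h : HasDerivAt (fun x => productExp (fun _ => x) f)
      (∑ z, f z * ∑ j, (∏ k ∈ Finset.univ.erase j, bernoulliWeight x (z k)) •
        (bernoulliWeight 1 (z j) - bernoulliWeight 0 (z j))) x := by
    unfold productExp
    exact HasDerivAt.fun_sum fun z _ => (HasDerivAt.fun_finsetProd
      fun k _ => hasDerivAt_bernoulliWeight (z k) x).const_mul _
  convert h using 1
  simp only [Finset.mul_sum]
  rw [Finset.sum_comm]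
  refine Finset.sum_congr rfl fun j _ => ?_
  rw [productExp_sub, ← productExp_update_one, ← productExp_update_zero]
  unfold productExp
  rw [← Finset.sum_sub_distrib]
  refine Finset.sum_congr rfl fun z _ => ?_
  have key : ∀ t : ℝ, ∏ k, bernoulliWeight (update (fun _ => x) j t k) (z k) =
      bernoulliWeight t (z j) * ∏ k ∈ Finset.univ.erase j, bernoulliWeight x (z k) := by
    intro t
    rw [← Finset.mul_prod_erase _ _ (Finset.mem_univ j), update_self]
    congr 1
    exact Finset.prod_congr rfl fun k hk => by rw [update_of_ne (Finset.ne_of_mem_erase hk)]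
  rw [key, key, smul_eq_mul]
  ring

/-! ### Vertex isoperimetry for increasing sets -/

/-- Inductive step over one coordinate: `a₀, a₁` are the slice probabilities of the set, `d₀, d₁`
those of its boundary. The variance `v` of the mixture exceeds the averaged slice variances by
`p(1-p)t²`, where `t = a₁ - a₀`. A small excess is absorbed by passing from `s` to `S`; a large one
forces `t` to be large, and then `t ≤ d₁` suffices. -/
lemma isoperimetric_step {s S p a₀ a₁ d₀ d₁ : ℝ} (hs : 1 ≤ s) (hS : 0 < S) (hsS : S ^ 2 = s ^ 2 + 1)
    (hp₀ : 0 ≤ p) (hp₁ : p ≤ 1) (ha₀ : 0 ≤ a₀) (h : a₀ ≤ a₁) (ha₁ : a₁ ≤ 1)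
    (hd₀ : a₀ * (1 - a₀) / (4 * s) ≤ d₀) (hd₁ : a₁ * (1 - a₁) / (4 * s) ≤ d₁)
    (hd : a₁ - a₀ ≤ d₁) :
    ((1 - p) * a₀ + p * a₁) * (1 - ((1 - p) * a₀ + p * a₁)) / (4 * S) ≤
      (1 - p) * d₀ + p * d₁ := by
  obtain ⟨t, rfl⟩ : ∃ t, a₁ = a₀ + t := ⟨a₁ - a₀, by ring⟩
  obtain ⟨v, hv⟩ : ∃ v, v = ((1 - p) * a₀ + p * (a₀ + t)) *
    (1 - ((1 - p) * a₀ + p * (a₀ + t))) := ⟨_, rfl⟩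
  rw [← hv]
  have ht : 0 ≤ t := by linarith
  have ht1 : t ≤ 1 := by linarith
  have hq : 0 ≤ 1 - p := by linarith
  have hpt : p * t ≤ t := by nlinarith
  have hpt0 : 0 ≤ p * t := by positivity
  have hv0 : 0 ≤ v := by
    rw [hv]
    exact mul_nonneg (by nlinarith) (by nlinarith)
  have hv4 : 4 * v ≤ 1 := by
    rw [hv]
    nlinarith [sq_nonneg (1 - 2 * ((1 - p) * a₀ + p * (a₀ + t)))]
  have hsS' : s ≤ S := by nlinarith
  have s0 : 0 < s := by linarith
  rw [div_le_iff₀ (by positivity)] at hd₀ hd₁ ⊢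
  by_cases hc : p * (1 - p) * t ^ 2 * (S * (S + s)) ≤ v
  · have e : ((1 - p) * d₀ + p * d₁) * (4 * s) ≥ v - p * (1 - p) * t ^ 2 := by
      have h1 := mul_le_mul_of_nonneg_left hd₀ hq
      have h2 := mul_le_mul_of_nonneg_left hd₁ hp₀
      rw [hv]
      nlinarith
    -- Since `(S - s)(S + s) = 1`, the case hypothesis says exactly that the excess is at most `v (S
    -- - s) / S`.
    have e2 : v * s ≤ (v - p * (1 - p) * t ^ 2) * S := by
      have : (v * (S - s) - p * (1 - p) * t ^ 2 * S) * (S + s) ≥ 0 := by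
        have : v * (S - s) * (S + s) = v := by
          linear_combination v * hsS
        nlinarith
      have := nonneg_of_mul_nonneg_left this (by linarith)
      linarith
    have e3 : v * s ≤ ((1 - p) * d₀ + p * d₁) * (4 * S) * s := by
      nlinarith [mul_le_mul_of_nonneg_right e hS.le]
    exact le_of_mul_le_mul_right e3 s0
  · push Not at hc
    have hts : 2 * v ≤ t * s := by
      have h1 : S * (S + s) ≤ 4 * s ^ 2 := by nlinarith
      have h2 : 4 * (p * (1 - p)) ≤ 1 := by nlinarith [sq_nonneg (1 - 2 * p)]
      have h3 : p * (1 - p) * t ^ 2 * (S * (S + s)) ≤ p * (1 - p) * t ^ 2 * (4 * s ^ 2) :=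
        mul_le_mul_of_nonneg_left h1 (by positivity)
      have h4 : 4 * (p * (1 - p)) * (t * s) ^ 2 ≤ 1 * (t * s) ^ 2 :=
        mul_le_mul_of_nonneg_right h2 (by positivity)
      have h5 : v ≤ (t * s) ^ 2 := by nlinarith
      -- From `4v ≤ 1` and `v ≤ (ts)²` follows `(2v)² ≤ v ≤ (ts)²`.
      refine le_of_sq_le_sq ?_ (by positivity)
      nlinarith
    have e : v ≤ ((1 - p) * d₀ + p * d₁) * (4 * s) := by
      have h1 := mul_le_mul_of_nonneg_left hd₀ hq
      have h2 : p * t * (4 * s) ≤ p * d₁ * (4 * s) := by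
        have : t ≤ d₁ := by linarith
        gcongr
      have hst : t ≤ t * s := le_mul_of_one_le_right ht hs
      have ha : (a₀ + t) * (1 - (a₀ + t)) ≤ v + t := by
        have : v + t - (a₀ + t) * (1 - (a₀ + t)) =
          t * (p + (1 - p) * (2 * a₀ + (1 + p) * t)) := by rw [hv]; ring
        have : 0 ≤ t * (p + (1 - p) * (2 * a₀ + (1 + p) * t)) := by positivity
        linarith
      -- The bracket is at most `v + 2t`, and `v ≤ ts/2`, `t ≤ ts`.
      have h3 : p * ((a₀ + t) * (1 - (a₀ + t)) + (1 - p) * t ^ 2) ≤ p * t * (4 * s) := by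
        rw [mul_assoc]
        refine mul_le_mul_of_nonneg_left ?_ hp₀
        have : (1 - p) * t ^ 2 ≤ t := by nlinarith [mul_nonneg hp₀ (sq_nonneg t)]
        nlinarith
      have h4 : (1 - p) * (a₀ * (1 - a₀)) + p * ((a₀ + t) * (1 - (a₀ + t)) + (1 - p) * t ^ 2) =
        v := by rw [hv]; ring
      nlinarith
    have h0 : 0 ≤ (1 - p) * d₀ + p * d₁ := by
      by_contra! hneg
      nlinarith
    nlinarith

/-- A vertex isoperimetric inequality for increasing subsets of the cube, uniform in the
product measure: `D` contains the inner vertex boundary of `A`. -/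
theorem isoperimetric_increasing {n : ℕ} (q : Fin n → ℝ) (hq : ∀ k, q k ∈ Set.Icc (0 : ℝ) 1)
    (A D : Set (Word n)) (hA : ∀ z k, update z k 0 ∈ A → update z k 1 ∈ A)
    (hD : ∀ z ∈ A, ∀ k, update z k 0 ∉ A → z ∈ D) :
    productProb q A * (1 - productProb q A) / (4 * √(n + 1)) ≤ productProb q D := by
  induction n with
  | zero =>
    have h : productProb q A * (1 - productProb q A) = 0 := by
      rcases A.eq_empty_or_nonempty with rfl | h
      · simp [productProb, productExp]
      · simp [productProb, productExp, Subsingleton.eq_univ_of_nonempty h]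
    rw [h, zero_div]
    exact productProb_nonneg hq D
  | succ n ih =>
    let ins (b : ZMod 2) (w : Word n) : Word (n + 1) :=
      (0 : Fin (n + 1)).insertNth (α := fun _ => ZMod 2) b w
    have upd (b c : ZMod 2) (w : Word n) : update (ins b w) 0 c = ins c w :=
      Fin.update_insertNth _ _ _ _
    have upd' (b c : ZMod 2) (w : Word n) (k : Fin n) :
        update (ins b w) ((0 : Fin (n + 1)).succAbove k) c = ins b (update w k c) :=
      (Fin.insertNth_update _ _ _ _ _).symm
    have split (E : Set (Word (n + 1))) : productProb q E =
        (1 - q 0) * productProb (fun k => q ((0 : Fin (n + 1)).succAbove k)) (ins 0 ⁻¹' E) +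
          q 0 * productProb (fun k => q ((0 : Fin (n + 1)).succAbove k)) (ins 1 ⁻¹' E) :=
      productExp_insertNth q 0 _
    have hq' : ∀ k, q ((0 : Fin (n + 1)).succAbove k) ∈ Set.Icc (0 : ℝ) 1 := fun k => hq _
    have slice (b : ZMod 2) := ih (fun k => q ((0 : Fin (n + 1)).succAbove k)) hq'
      (ins b ⁻¹' A) (ins b ⁻¹' D)
      (fun z k h => by
        simp only [Set.mem_preimage, ← upd' b] at h ⊢
        exact hA _ _ h)
      (fun z h k hk => hD _ h ((0 : Fin (n + 1)).succAbove k) (by rwa [upd']))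
    have hsub : ins 0 ⁻¹' A ⊆ ins 1 ⁻¹' A := fun w hw => by
      have := hA (ins 0 w) 0
      rw [upd, upd] at this
      exact this hw
    -- A point of the upper slice of `A` whose lower neighbour is outside `A` is a boundary point in
    -- the split direction.
    have hdiff : productProb (fun k => q ((0 : Fin (n + 1)).succAbove k)) (ins 1 ⁻¹' A) -
        productProb (fun k => q ((0 : Fin (n + 1)).succAbove k)) (ins 0 ⁻¹' A) ≤
        productProb (fun k => q ((0 : Fin (n + 1)).succAbove k)) (ins 1 ⁻¹' D) := by
      rw [productProb, productProb, ← productExp_sub]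
      refine productExp_mono hq' fun w => ?_
      by_cases h1 : w ∈ ins 1 ⁻¹' A <;> by_cases h0 : w ∈ ins 0 ⁻¹' A <;>
        by_cases hd : w ∈ ins 1 ⁻¹' D
      all_goals simp only [Set.indicator_of_mem, Set.indicator_of_notMem, h1, h0, hd,
        not_false_eq_true, Pi.one_apply]
      all_goals norm_num
      exact hd (hD (ins 1 w) h1 0 (by rwa [upd]))
    rw [split A, split D]
    refine isoperimetric_step (s := √(n + 1)) ?_ (by positivity) ?_ (hq 0).1 (hq 0).2
      (productProb_nonneg hq' _) (productProb_mono hq' hsub) (productProb_le_one hq' _)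
      (slice 0) (slice 1) hdiff
    · rw [Real.one_le_sqrt]
      linarith [(Nat.cast_nonneg n : (0 : ℝ) ≤ n)]
    · rw [Real.sq_sqrt (by positivity), Real.sq_sqrt (by positivity)]
      push_cast
      ring

/-! ### Covered codewords, pivotality and the dimension-one event -/

/-- The erasure patterns `z` for which the bit `i` is not determined by the other outputs:
some codeword `c` with `c i = 1` is covered by `z` off the coordinate `i`. -/
def undetermined {n : ℕ} (C : LinearCode n) (i : Fin n) : Set (Word n) :=
  {z | ∃ c ∈ C, c i = 1 ∧ ∀ k, k ≠ i → c k = 1 → z k = 1}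

/-- The patterns covering a codeword that does not vanish at both of `i` and `j`. -/
def coversNonzero {n : ℕ} (C : LinearCode n) (i j : Fin n) : Set (Word n) :=
  {z | ∃ c ∈ C, (c i = 1 ∨ c j = 1) ∧ Covers z c}

/-- The parameters of independent bits equal to `1` at `i` and `j`. -/
def pairParam {n : ℕ} (ε : ℝ) (i j : Fin n) : Fin n → ℝ :=
  update (update (fun _ => ε) j 1) i 1

lemma pairParam_mem {n : ℕ} {ε : ℝ} (hε : ε ∈ Set.Icc (0 : ℝ) 1) (i j k : Fin n) :
    pairParam ε i j k ∈ Set.Icc (0 : ℝ) 1 := by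
  unfold pairParam
  simp only [update_apply]
  split_ifs
  · simp
  · simp
  · exact hε

lemma patternProb_eq {n : ℕ} (ε : ℝ) (i j : Fin n) (A : Set (Word n)) :
    patternProb ε i j A = productProb (pairParam ε i j) A := by
  unfold patternProb productProb productExp
  refine Finset.sum_congr rfl fun z _ => ?_
  have h : patternPMF ε i j z = ∏ k, bernoulliWeight (pairParam ε i j k) (z k) := by
    refine Finset.prod_congr rfl fun k _ => ?_
    by_cases hi : k = i <;> by_cases hj : k = j <;> by_cases hz : z k = 1 <;>
      simp_all [pairParam, bernoulliWeight]
  by_cases hz : z ∈ A <;> simp [hz, h]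

lemma productProb_pairParam {n : ℕ} (ε : ℝ) (i j : Fin n) (A : Set (Word n)) :
    productProb (pairParam ε i j) A =
      productProb (fun _ => ε) ((fun z => update (update z i 1) j 1) ⁻¹' A) := by
  classical
  rw [productProb, pairParam, productExp_update_one, productExp_update_one]
  refine congrArg _ (funext fun z => ?_)
  rcases eq_or_ne i j with rfl | h
  · simp [Set.indicator_apply]
  · simp [Set.indicator_apply, update_comm h]

lemma one_add_one_zmod_two : (1 : ZMod 2) + 1 = 0 := by decide

lemma zmod_two_add_eq_one {a b : ZMod 2} (h : a + b = 1) : a = 1 ∨ b = 1 := by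
  revert a b; decide

lemma Covers.add {n : ℕ} {z a b : Word n} (ha : Covers z a) (hb : Covers z b) :
    Covers z (a + b) := fun k hk => (zmod_two_add_eq_one hk).elim (ha k) (hb k)

lemma CoversSome.add {n : ℕ} {C : LinearCode n} {i j : Fin n} {s t s' t' : ZMod 2} {z : Word n}
    (h : CoversSome C i j s t z) (h' : CoversSome C i j s' t' z) :
    CoversSome C i j (s + s') (t + t') z := by
  obtain ⟨c, hc, hi, hj, hz⟩ := h
  obtain ⟨d, hd, hi', hj', hz'⟩ := h'
  exact ⟨c + d, C.add_mem hc hd, by simp [hi, hi'], by simp [hj, hj'], hz.add hz'⟩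

lemma mem_coversNonzero_iff {n : ℕ} {C : LinearCode n} {i j : Fin n} {z : Word n} :
    z ∈ coversNonzero C i j ↔
      CoversSome C i j 0 1 z ∨ CoversSome C i j 1 0 z ∨ CoversSome C i j 1 1 z := by
  constructor
  · rintro ⟨c, hc, h, hz⟩
    by_cases hi : c i = 1 <;> by_cases hj : c j = 1
    · exact Or.inr (Or.inr ⟨c, hc, hi, hj, hz⟩)
    · exact Or.inr (Or.inl ⟨c, hc, hi, zmod_two_eq_zero hj, hz⟩)
    · exact Or.inl ⟨c, hc, zmod_two_eq_zero hi, hj, hz⟩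
    · exact absurd h (by simp [hi, hj])
  · rintro (⟨c, hc, hi, hj, hz⟩ | ⟨c, hc, hi, hj, hz⟩ | ⟨c, hc, hi, hj, hz⟩)
    · exact ⟨c, hc, Or.inr hj, hz⟩
    · exact ⟨c, hc, Or.inl hi, hz⟩
    · exact ⟨c, hc, Or.inl hi, hz⟩

/-- The covered pairs `(c i, c j)` are closed under addition, so any two distinct nonzero pairs
produce the third; exactly one occurs unless all three do. -/
lemma mem_rankOne_iff {n : ℕ} {C : LinearCode n} {i j : Fin n} {z : Word n} :
    z ∈ B2 C i j ∪ B3 C i j ∪ B4 C i j ↔ z ∈ coversNonzero C i j ∧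
      ¬ (CoversSome C i j 0 1 z ∧ CoversSome C i j 1 0 z) := by
  rw [mem_coversNonzero_iff]
  have h1 : CoversSome C i j 0 1 z → CoversSome C i j 1 0 z → CoversSome C i j 1 1 z :=
    fun h h' => by simpa using h.add h'
  have h2 : CoversSome C i j 0 1 z → CoversSome C i j 1 1 z → CoversSome C i j 1 0 z :=
    fun h h' => by simpa [one_add_one_zmod_two] using h.add h'
  have h3 : CoversSome C i j 1 0 z → CoversSome C i j 1 1 z → CoversSome C i j 0 1 z :=
    fun h h' => by simpa [one_add_one_zmod_two] using h.add h'
  simp only [B2, B3, B4, Set.mem_union, Set.mem_ofPred_eq]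
  tauto

/-- If deleting `k` uncovers every codeword that is nonzero on `{i, j}`, all of these have a `1` at
`k`. In dimension two the sum of two of them is another one, yet vanishes at `k`. -/
lemma rankOne_of_boundary {n : ℕ} {C : LinearCode n} {i j : Fin n} {z : Word n}
    (hz : z ∈ coversNonzero C i j) (k : Fin n) (hk : update z k 0 ∉ coversNonzero C i j) :
    z ∈ B2 C i j ∪ B3 C i j ∪ B4 C i j := by
  refine mem_rankOne_iff.2 ⟨hz, ?_⟩
  rintro ⟨⟨c, hc, hci, hcj, hcz⟩, ⟨d, hd, hdi, hdj, hdz⟩⟩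
  have removed : ∀ e ∈ C, (e i = 1 ∨ e j = 1) → Covers z e → e k = 1 := by
    intro e he hij hez
    by_contra hek
    refine hk ⟨e, he, hij, fun l hl => ?_⟩
    have : l ≠ k := by rintro rfl; exact hek hl
    rw [update_of_ne this]
    exact hez l hl
  have h1 := removed c hc (Or.inr hcj) hcz
  have h2 := removed d hd (Or.inl hdi) hdz
  have h3 := removed (c + d) (C.add_mem hc hd) (Or.inl (by simp [hci, hdi])) (hcz.add hdz)
  simp [h1, h2, one_add_one_zmod_two] at h3

lemma coversNonzero_increasing {n : ℕ} {C : LinearCode n} {i j : Fin n} (z : Word n) (k : Fin n)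
    (h : update z k 0 ∈ coversNonzero C i j) : update z k 1 ∈ coversNonzero C i j := by
  obtain ⟨c, hc, hij, hz⟩ := h
  refine ⟨c, hc, hij, fun l hl => ?_⟩
  rcases eq_or_ne l k with rfl | hlk
  · simp
  · have := hz l hl
    rwa [update_of_ne hlk] at this ⊢

/-- Pivotality of `j` means that codewords with `c i = 1` are available, but only ones with `c j =
1`: type `11` occurs and `10` does not. Type `01` is then excluded, since adding `11` to it gives
`10`. -/
lemma pivotal_iff {n : ℕ} {C : LinearCode n} {i j : Fin n} (hij : i ≠ j) (z : Word n) :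
    update (update z i 1) j 1 ∈ B4 C i j ↔
      update z j 1 ∈ undetermined C i ∧ update z j 0 ∉ undetermined C i := by
  have cov : ∀ c : Word n, Covers (update (update z i 1) j 1) c ↔
      ∀ k, k ≠ i → k ≠ j → c k = 1 → z k = 1 := by
    intro c
    refine forall_congr' fun k => ?_
    by_cases hi : k = i <;> by_cases hj : k = j <;> simp_all
  have und₁ : update z j 1 ∈ undetermined C i ↔
      ∃ c ∈ C, c i = 1 ∧ ∀ k, k ≠ i → k ≠ j → c k = 1 → z k = 1 := by
    refine exists_congr fun c => and_congr_right fun _ => and_congr_right fun _ =>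
      forall_congr' fun k => ?_
    by_cases hj : k = j <;> simp_all
  have und₀ : update z j 0 ∈ undetermined C i ↔
      ∃ c ∈ C, c i = 1 ∧ c j = 0 ∧ ∀ k, k ≠ i → k ≠ j → c k = 1 → z k = 1 := by
    refine exists_congr fun c => and_congr_right fun _ => and_congr_right fun _ => ?_
    constructor
    · intro h
      refine ⟨zmod_two_eq_zero fun hj => ?_, fun k hi hj hk => ?_⟩
      · simpa using h j hij.symm hj
      · simpa [update_of_ne hj] using h k hi hk
    · rintro ⟨h0, h⟩ k hi hk
      have hj : k ≠ j := by rintro rfl; simp [h0] at hk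
      rw [update_of_ne hj]
      exact h k hi hj hk
  rw [und₁, und₀]
  simp only [B4, Set.mem_ofPred_eq]
  constructor
  · rintro ⟨⟨c, hc, hci, -, hz⟩, -, h10⟩
    refine ⟨⟨c, hc, hci, (cov c).1 hz⟩, ?_⟩
    rintro ⟨d, hd, hdi, hdj, hdz⟩
    exact h10 ⟨d, hd, hdi, hdj, (cov d).2 hdz⟩
  · rintro ⟨⟨c, hc, hci, hz⟩, h⟩
    have h10 : ¬ CoversSome C i j 1 0 (update (update z i 1) j 1) := by
      rintro ⟨d, hd, hdi, hdj, hdz⟩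
      exact h ⟨d, hd, hdi, hdj, (cov d).1 hdz⟩
    have h11 : CoversSome C i j 1 1 (update (update z i 1) j 1) := by
      refine ⟨c, hc, hci, by_contra fun hcj => ?_, (cov c).2 hz⟩
      exact h10 ⟨c, hc, hci, zmod_two_eq_zero hcj, (cov c).2 hz⟩
    refine ⟨h11, fun h01 => h10 ?_, h10⟩
    simpa [one_add_one_zmod_two] using h01.add h11

lemma undetermined_increasing {n : ℕ} {C : LinearCode n} {i : Fin n} (z : Word n) (j : Fin n)
    (h : update z j 0 ∈ undetermined C i) : update z j 1 ∈ undetermined C i := by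
  obtain ⟨c, hc, hi, hz⟩ := h
  refine ⟨c, hc, hi, fun k hk hck => ?_⟩
  rcases eq_or_ne k j with rfl | hj
  · simp
  · have := hz k hk hck
    rwa [update_of_ne hj] at this ⊢

lemma update_self_mem_undetermined {n : ℕ} {C : LinearCode n} {i : Fin n} (z : Word n)
    (b : ZMod 2) : update z i b ∈ undetermined C i ↔ z ∈ undetermined C i := by
  refine exists_congr fun c => and_congr_right fun _ => and_congr_right fun _ =>
    forall_congr' fun k => imp_congr_right fun hk => ?_
  rw [update_of_ne hk]

lemma hasDerivAt_undetermined {n : ℕ} (C : LinearCode n) (i : Fin n) (ε : ℝ) :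
    HasDerivAt (fun ε => productProb (fun _ => ε) (undetermined C i))
      (∑ j ∈ Finset.univ.erase i, patternProb ε i j (B4 C i j)) ε := by
  classical
  change HasDerivAt (fun ε => productExp (fun _ => ε) ((undetermined C i).indicator 1)) _ ε
  convert hasDerivAt_productExp ((undetermined C i).indicator 1) ε using 1
  rw [← Finset.add_sum_erase _ _ (Finset.mem_univ i)]
  -- The event ignores coordinate `i`, so the diagonal term of Russo's formula vanishes.
  have h0 : productExp (fun _ => ε) (fun z => (undetermined C i).indicator 1 (update z i 1) -
      (undetermined C i).indicator (1 : Word n → ℝ) (update z i 0)) = 0 := by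
    simp [productExp, Set.indicator_apply, update_self_mem_undetermined]
  rw [h0, zero_add]
  refine Finset.sum_congr rfl fun j hj => ?_
  have hij : i ≠ j := (Finset.ne_of_mem_erase hj).symm
  rw [patternProb_eq, productProb_pairParam, productProb]
  refine congrArg _ (funext fun z => ?_)
  have h1 := pivotal_iff (C := C) hij z
  have h2 := undetermined_increasing (C := C) (i := i) z j
  by_cases ha : update z j 1 ∈ undetermined C i <;>
    by_cases hb : update z j 0 ∈ undetermined C i <;> simp_all [Set.indicator_apply]

lemma productProb_undetermined_eq {n : ℕ} {C : LinearCode n} (hC : OneTransitive C) (ε : ℝ)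
    (i j : Fin n) : productProb (fun _ => ε) (undetermined C i) =
      productProb (fun _ => ε) (undetermined C j) := by
  obtain ⟨π, rfl, hπ⟩ := hC i j
  have mem (z : Word n) : z ∘ π ∈ undetermined C i ↔ z ∈ undetermined C (π i) := by
    constructor
    · rintro ⟨c, hc, hi, hz⟩
      refine ⟨c ∘ π.symm, (hπ _).1 ?_, by simpa using hi, fun k hk hck => ?_⟩
      · simpa [comp_assoc] using hc
      · have hne : π.symm k ≠ i := by
          rintro rfl
          simp at hk
        simpa using hz (π.symm k) hne hck
    · rintro ⟨c, hc, hi, hz⟩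
      exact ⟨c ∘ π, (hπ c).2 hc, hi, fun k hk hck => hz (π k) (by simpa using hk) hck⟩
  classical
  unfold productProb productExp
  rw [← (Equiv.arrowCongr π.symm (Equiv.refl (ZMod 2))).sum_comp]
  refine Finset.sum_congr rfl fun z _ => ?_
  have hz : (Equiv.arrowCongr π.symm (Equiv.refl (ZMod 2))) z = z ∘ π := by
    ext k; simp
  rw [hz, ← Equiv.prod_comp π (fun k => bernoulliWeight ε (z k))]
  simp only [Set.indicator_apply, mem, comp_apply, Pi.one_apply]

lemma rankOne_lower_bound {n : ℕ} (C : LinearCode n) {ε δ : ℝ} (hε : ε ∈ Set.Icc (0 : ℝ) 1)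
    (hδ : 0 < δ) (hδ' : δ ≤ 1 / 2) {i j : Fin n} (hij : i ≠ j)
    (hg : productProb (fun _ => ε) (undetermined C i) ∈ Set.Ioo δ (1 - δ)) :
    δ ^ 2 / 16 / √n ≤ patternProb ε i j (B2 C i j ∪ B3 C i j ∪ B4 C i j) := by
  classical
  have hq := pairParam_mem hε i j
  have hn : (1 : ℝ) ≤ n := by exact_mod_cast i.pos
  have hs : 1 ≤ √(n : ℝ) := by rwa [Real.one_le_sqrt]
  have hs2 : √((n : ℝ) + 1) ≤ 2 * √n := by
    rw [Real.sqrt_le_left (by positivity), mul_pow, Real.sq_sqrt (by positivity)]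
    linarith
  have hiso := isoperimetric_increasing (pairParam ε i j) hq (coversNonzero C i j)
    (B2 C i j ∪ B3 C i j ∪ B4 C i j) coversNonzero_increasing
    fun z hz k hk => rankOne_of_boundary hz k hk
  have hga : productProb (fun _ => ε) (undetermined C i) ≤
      productProb (pairParam ε i j) (coversNonzero C i j) := by
    rw [productProb_pairParam]
    refine productProb_mono (fun _ => hε) ?_
    rintro z ⟨c, hc, hi, hz⟩
    refine ⟨c, hc, Or.inl hi, fun k hk => ?_⟩
    by_cases h1 : k = i <;> by_cases h2 : k = j <;> simp_all
  -- In dimension two a codeword of type `10` is covered; as it vanishes at `j`, it shows bit `i`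
  -- undetermined without the forced erasure at `j`.
  have hag : productProb (pairParam ε i j) (coversNonzero C i j) ≤
      productProb (fun _ => ε) (undetermined C i) +
        productProb (pairParam ε i j) (B2 C i j ∪ B3 C i j ∪ B4 C i j) := by
    rw [productProb_pairParam, productProb_pairParam, productProb, productProb, productProb,
      ← productExp_add]
    refine productExp_mono (fun _ => hε) fun z => ?_
    have h2 : CoversSome C i j 1 0 (update (update z i 1) j 1) → z ∈ undetermined C i := by
      rintro ⟨c, hc, hi, hj, hz⟩
      refine ⟨c, hc, hi, fun k hk hck => ?_⟩
      have hkj : k ≠ j := by rintro rfl; simp [hj] at hck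
      simpa [update_apply, hk, hkj] using hz k hck
    have h3 : update (update z i 1) j 1 ∈ coversNonzero C i j → z ∉ undetermined C i →
        update (update z i 1) j 1 ∈ B2 C i j ∪ B3 C i j ∪ B4 C i j :=
      fun h h' => mem_rankOne_iff.2 ⟨h, fun h'' => h' (h2 h''.2)⟩
    simp only [Set.indicator_apply, Set.mem_preimage, Pi.one_apply]
    split_ifs <;> first | exact absurd (h3 ‹_› ‹_›) ‹_› | norm_num
  rw [patternProb_eq]
  have ha1 := productProb_le_one hq (coversNonzero C i j)
  generalize productProb (pairParam ε i j) (coversNonzero C i j) = a at *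
  generalize productProb (pairParam ε i j) (B2 C i j ∪ B3 C i j ∪ B4 C i j) = d at *
  generalize productProb (fun _ => ε) (undetermined C i) = g at *
  obtain ⟨hg1, hg2⟩ := hg
  -- Here `δ < g ≤ a ≤ g + d`. If `a ≤ 1 - δ/2` then `a(1 - a) ≥ δ²/2`, and `4√(n+1) ≤ 8√n` yields
  -- the `16`. Otherwise `d ≥ a - g > δ/2`.
  by_cases ha : a ≤ 1 - δ / 2
  · refine le_trans ?_ hiso
    have : δ ^ 2 / 2 ≤ a * (1 - a) := by nlinarith
    rw [div_div, div_le_div_iff₀ (by positivity) (by positivity)]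
    nlinarith [mul_le_mul this hs2 (by positivity) (by nlinarith)]
  · refine le_trans (div_le_self (by positivity) hs) ?_
    nlinarith

/-! ### Entropy of a bit as the probability of being undetermined -/

lemma neg_sum_mul_logb_of_eq (a : ℝ) :
    -(a * Real.logb 2 (a / (a + a)) + a * Real.logb 2 (a / (a + a))) = a + a := by
  rcases eq_or_ne a 0 with rfl | ha
  · simp
  · have h : a / (a + a) = 2⁻¹ := by field_simp; norm_num
    rw [h, Real.logb_inv, Real.logb_self_eq_one (by norm_num)]
    ring

lemma neg_sum_mul_logb_of_eq_zero {a b : ℝ} (h : a = 0 ∨ b = 0) :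
    -(a * Real.logb 2 (a / (a + b)) + b * Real.logb 2 (b / (a + b))) = 0 := by
  rcases h with rfl | rfl
  · rcases eq_or_ne b 0 with rfl | h <;> simp [*]
  · rcases eq_or_ne a 0 with rfl | h <;> simp [*]

lemma lawOf_bit_add {Ω β : Type*} [Fintype Ω] (p : Ω → ℝ) (U : Ω → ZMod 2) (V : Ω → β) (v : β) :
    lawOf p V v =
      lawOf p (fun ω => (U ω, V ω)) (0, v) + lawOf p (fun ω => (U ω, V ω)) (1, v) := by
  classical
  unfold lawOf
  rw [← Finset.sum_add_distrib]
  refine Finset.sum_congr rfl fun ω _ => ?_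
  by_cases hU : U ω = 1
  · by_cases hV : V ω = v <;> simp [hU, hV]
  · by_cases hV : V ω = v <;> simp [zmod_two_eq_zero hU, hV]

/-- The entropy of a bit that, given `V = v`, is unbiased for `v ∈ S` and deterministic
otherwise. -/
lemma condEntropy_bit {Ω β : Type*} [Fintype Ω] [Fintype β] (p : Ω → ℝ) (U : Ω → ZMod 2)
    (V : Ω → β) (S : Set β)
    (hS : ∀ v ∈ S, lawOf p (fun ω => (U ω, V ω)) (0, v) = lawOf p (fun ω => (U ω, V ω)) (1, v))
    (hS' : ∀ v ∉ S, lawOf p (fun ω => (U ω, V ω)) (0, v) = 0 ∨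
      lawOf p (fun ω => (U ω, V ω)) (1, v) = 0) :
    condEntropy p U V = ∑ ω, p ω * (V ⁻¹' S).indicator 1 ω := by
  classical
  have h : condEntropy p U V = ∑ v, S.indicator (lawOf p V) v := by
    unfold condEntropy
    rw [zmod_two_sum, ← Finset.sum_add_distrib, ← Finset.sum_neg_distrib]
    refine Finset.sum_congr rfl fun v _ => ?_
    rw [Set.indicator_apply]
    simp only [lawOf_bit_add p U V v]
    split_ifs with hv
    · rw [hS v hv]
      exact neg_sum_mul_logb_of_eq _
    · exact neg_sum_mul_logb_of_eq_zero (hS' v hv)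
  rw [h]
  have h' : ∀ v, S.indicator (lawOf p V) v =
      ∑ ω, if V ω = v then p ω * (V ⁻¹' S).indicator 1 ω else 0 := by
    intro v
    rw [Set.indicator_apply]
    split_ifs with hv
    · refine Finset.sum_congr rfl fun ω _ => ?_
      by_cases hω : V ω = v <;> simp [hω, hv]
    · refine (Finset.sum_eq_zero fun ω _ => ?_).symm
      by_cases hω : V ω = v <;> simp [hω, hv]
  simp only [h']
  rw [Finset.sum_comm]
  exact Finset.sum_congr rfl fun ω _ => by simp

/-- The erasure indicator of a channel output. -/
def erasureBit : Option (ZMod 2) → ZMod 2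
  | none => 1
  | some _ => 0

lemma sum_becKernel (ε : ℝ) (x b : ZMod 2) :
    ∑ y, becKernel ε x y * (if erasureBit y = b then 1 else 0) = bernoulliWeight ε b := by
  rw [Fintype.sum_option, zmod_two_sum]
  by_cases hb : b = 1
  · subst hb
    simp [becKernel, erasureBit]
  · obtain rfl := zmod_two_eq_zero hb
    by_cases hx : x = 1
    · subst hx
      simp [becKernel, erasureBit]
    · obtain rfl := zmod_two_eq_zero hx
      simp [becKernel, erasureBit]

/-- The erasure pattern is a vector of independent Bernoulli bits whatever the input. -/
lemma sum_prod_becKernel {n : ℕ} (ε : ℝ) (x : Word n) (f : Word n → ℝ) :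
    ∑ y : Output n, (∏ k, becKernel ε (x k) (y k)) * f (fun k => erasureBit (y k)) =
      productExp (fun _ => ε) f := by
  classical
  unfold productExp
  have h (y : Output n) : (∏ k, becKernel ε (x k) (y k)) * f (fun k => erasureBit (y k)) =
      ∑ z, f z * ∏ k, becKernel ε (x k) (y k) * (if erasureBit (y k) = z k then 1 else 0) := by
    rw [Finset.sum_eq_single fun k => erasureBit (y k)]
    · simp [mul_comm]
    · intro z _ hz
      obtain ⟨k, hk⟩ := Function.ne_iff.1 hz
      rw [Finset.prod_eq_zero (Finset.mem_univ k) (by rw [if_neg hk.symm, mul_zero]), mul_zero]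
    · simp
  simp only [h]
  rw [Finset.sum_comm]
  refine Finset.sum_congr rfl fun z _ => ?_
  rw [← Finset.mul_sum, ← Fintype.prod_sum (fun k y => becKernel ε (x k) y *
    (if erasureBit y = z k then 1 else 0))]
  simp only [sum_becKernel]

lemma sum_jointPMF_mul {n : ℕ} (C : LinearCode n) (ε : ℝ) (f : Word n → ℝ) :
    ∑ ω, jointPMF C ε ω * f (fun k => erasureBit (ω.2 k)) = productExp (fun _ => ε) f := by
  classical
  rw [Fintype.sum_prod_type]
  have hx (x : Word n) : ∑ y : Output n, jointPMF C ε (x, y) * f (fun k => erasureBit (y k)) =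
      (if x ∈ C then (Nat.card C : ℝ)⁻¹ else 0) * productExp (fun _ => ε) f := by
    rw [← sum_prod_becKernel ε x f, Finset.mul_sum]
    refine Finset.sum_congr rfl fun y _ => ?_
    rw [← mul_assoc]
    congr
  simp only [hx]
  rw [← Finset.sum_mul, ← Finset.sum_filter, Finset.sum_const, nsmul_eq_mul]
  have h : ((Finset.univ.filter fun x => x ∈ C).card : ℝ) = Nat.card C := by
    rw [Nat.card_eq_fintype_card, Fintype.card_subtype]
  have h0 : (Nat.card C : ℝ) ≠ 0 := by exact_mod_cast Nat.card_pos.ne'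
  rw [h, mul_inv_cancel₀ h0, one_mul]

/-- Adding the codeword `c` to the input and to the unerased outputs. -/
def shiftEquiv {n : ℕ} (c : Word n) : Word n × Output n ≃ Word n × Output n :=
  (Equiv.addRight c).prodCongr (Equiv.piCongrRight fun k => (Equiv.addRight (c k)).optionCongr)

lemma jointPMF_shiftEquiv {n : ℕ} (C : LinearCode n) (ε : ℝ) {c : Word n} (hc : c ∈ C)
    (ω : Word n × Output n) : jointPMF C ε (shiftEquiv c ω) = jointPMF C ε ω := by
  have h1 : (shiftEquiv c ω).1 ∈ C ↔ ω.1 ∈ C := C.add_mem_iff_left hc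
  have h2 (k : Fin n) : becKernel ε ((shiftEquiv c ω).1 k) ((shiftEquiv c ω).2 k) =
      becKernel ε (ω.1 k) (ω.2 k) := by
    change becKernel ε (ω.1 k + c k) ((ω.2 k).map (· + c k)) = _
    cases ω.2 k <;> simp [becKernel]
  simp only [jointPMF, h2]
  congr 1
  by_cases h : ω.1 ∈ C
  · rw [if_pos h, if_pos (h1.2 h)]
  · rw [if_neg h, if_neg (mt h1.1 h)]

lemma eq_of_jointPMF_ne_zero {n : ℕ} {C : LinearCode n} {ε : ℝ} {ω : Word n × Output n}
    (h : jointPMF C ε ω ≠ 0) : ω.1 ∈ C ∧ ∀ k b, ω.2 k = some b → ω.1 k = b := by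
  constructor
  · by_contra hC
    simp [jointPMF, hC] at h
  · intro k b hk
    by_contra hb
    refine right_ne_zero_of_mul h (Finset.prod_eq_zero (Finset.mem_univ k) ?_)
    simp [becKernel, hk, Ne.symm hb]

lemma erasureBit_eq_one_iff {y : Option (ZMod 2)} : erasureBit y = 1 ↔ y = none := by
  cases y <;> simp [erasureBit]

/-- Given the other outputs, the bit is either unbiased or deterministic, and which one depends only
on the erasure pattern. The identity holds for every real `ε`, so the EXIT function has a two-sided
derivative even at the endpoints. -/
lemma bitEntropy_eq {n : ℕ} (C : LinearCode n) (ε : ℝ) (i : Fin n) :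
    bitEntropy C ε i = productProb (fun _ => ε) (undetermined C i) := by
  classical
  let S : Set ({k : Fin n // k ≠ i} → Option (ZMod 2)) :=
    {v | ∃ c ∈ C, c i = 1 ∧ ∀ k : {k : Fin n // k ≠ i}, c k = 1 → v k = none}
  unfold bitEntropy
  rw [condEntropy_bit _ _ _ S, productProb, ← sum_jointPMF_mul C]
  · refine Finset.sum_congr rfl fun ω _ => ?_
    congr 1
    have h : (fun k : {k : Fin n // k ≠ i} => ω.2 k) ∈ S ↔
        (fun k => erasureBit (ω.2 k)) ∈ undetermined C i := by
      simp [S, undetermined, erasureBit_eq_one_iff]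
    simp only [Set.indicator_apply, Set.mem_preimage, h, Pi.one_apply]
  -- Shifting by `c` preserves the joint law and the observation `v`, since `c` is supported on
  -- erasures off `i`, and flips bit `i`.
  · rintro v ⟨c, hc, hi, hv⟩
    unfold lawOf
    rw [← (shiftEquiv c).sum_comp]
    refine Finset.sum_congr rfl fun ω _ => ?_
    rw [jointPMF_shiftEquiv C ε hc]
    have h1 : (shiftEquiv c ω).1 i = 0 ↔ ω.1 i = 1 := by
      change ω.1 i + c i = 0 ↔ _
      rw [hi]
      generalize ω.1 i = b
      revert b
      decide
    have h2 : ((fun k : {k : Fin n // k ≠ i} => (shiftEquiv c ω).2 k) = v) ↔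
        (fun k : {k : Fin n // k ≠ i} => ω.2 k) = v := by
      simp only [funext_iff]
      refine forall_congr' fun k => ?_
      change (ω.2 k).map (· + c k) = v k ↔ _
      by_cases hk : c k = 1
      · simp [hv k hk]
      · simp [zmod_two_eq_zero hk]
    simp only [Prod.mk.injEq, h1, h2]
  -- Two codewords consistent with `v` that differ at `i` have a sum witnessing `v ∈ S`.
  · intro v hv
    by_contra! h
    obtain ⟨ω, -, hω⟩ := Finset.exists_ne_zero_of_sum_ne_zero h.1
    obtain ⟨ω', -, hω'⟩ := Finset.exists_ne_zero_of_sum_ne_zero h.2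
    simp only [ne_eq, ite_eq_right_iff, Classical.not_imp, Prod.mk.injEq] at hω hω'
    obtain ⟨⟨hi, rfl⟩, hω⟩ := hω
    obtain ⟨⟨hi', hv'⟩, hω'⟩ := hω'
    have h1 := eq_of_jointPMF_ne_zero hω
    have h2 := eq_of_jointPMF_ne_zero hω'
    refine hv ⟨ω.1 + ω'.1, C.add_mem h1.1 h2.1, by simp [hi, hi'], fun k hk => ?_⟩
    by_contra hne
    obtain ⟨b, hb⟩ := Option.ne_none_iff_exists'.1 hne
    have hb' : ω'.2 k = some b := (congrFun hv' k).trans hb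
    have e1 := h1.2 k b hb
    have e2 := h2.2 k b hb'
    rw [Pi.add_apply, e1, e2, CharTwo.add_self_eq_zero] at hk
    exact zero_ne_one hk

/-! ### The derivative of the EXIT function and the final bound -/

lemma exitFunction_eq {n : ℕ} {C : LinearCode n} (hC : OneTransitive C) (ε : ℝ) (i : Fin n) :
    exitFunction C ε = productProb (fun _ => ε) (undetermined C i) := by
  have hn : (n : ℝ) ≠ 0 := by exact_mod_cast i.pos.ne'
  simp only [exitFunction, bitEntropy_eq, fun j => productProb_undetermined_eq hC ε j i]
  simp [hn]

lemma hasDerivAt_exitFunction {n : ℕ} (C : LinearCode n) (ε : ℝ) :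
    HasDerivAt (exitFunction C)
      (1 / (n : ℝ) * ∑ i, ∑ j ∈ Finset.univ.erase i, patternProb ε i j (B4 C i j)) ε := by
  have h : exitFunction C =
      fun ε => 1 / (n : ℝ) * ∑ i, productProb (fun _ => ε) (undetermined C i) := by
    funext x
    simp only [exitFunction, bitEntropy_eq]
  rw [h]
  exact (HasDerivAt.fun_sum fun i _ => hasDerivAt_undetermined C i ε).const_mul _

lemma alpha_mul_le {n : ℕ} (C : LinearCode n) {ε : ℝ} (hε : ε ∈ Set.Icc (0 : ℝ) 1) {i j : Fin n}
    {r : ℝ} (hr : r ≤ patternProb ε i j (B2 C i j ∪ B3 C i j ∪ B4 C i j)) :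
    r * alpha C ε i j ≤ patternProb ε i j (B4 C i j) := by
  unfold alpha
  simp only [patternProb_eq] at hr ⊢
  have h4 := productProb_nonneg (pairParam_mem hε i j) (B4 C i j)
  rcases (productProb_nonneg (pairParam_mem hε i j)
    (B2 C i j ∪ B3 C i j ∪ B4 C i j)).eq_or_lt with h | h
  -- If the conditioning event has probability `0`, division by zero makes `alpha` equal to `0`.
  · simpa [← h] using h4
  · rw [mul_div_assoc', div_le_iff₀ h, mul_comm]
    exact mul_le_mul_of_nonneg_left hr h4

end ExitBEC

end

theorem theorem5 :
    ∃ c : ℝ → ℝ,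
      (∀ δ₀ : ℝ, 0 < δ₀ → ∃ c₀ : ℝ, 0 < c₀ ∧ ∀ δ : ℝ, δ₀ ≤ δ → δ ≤ 1 / 2 → c₀ ≤ c δ) ∧
      ∀ δ : ℝ, 0 < δ → δ ≤ 1 / 2 →
        ∀ (n : ℕ) (C : ExitBEC.LinearCode n), ExitBEC.OneTransitive C →
          ∀ ε : ℝ, ε ∈ Set.Icc (0 : ℝ) 1 →
            ExitBEC.exitFunction C ε ∈ Set.Ioo δ (1 - δ) →
              DifferentiableWithinAt ℝ (ExitBEC.exitFunction C) (Set.Icc (0 : ℝ) 1) ε ∧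
              c δ / (n : ℝ) ^ (3 / 2 : ℝ) *
                  ∑ i : Fin n, ∑ j ∈ Finset.univ.erase i, ExitBEC.alpha C ε i j ≤
                derivWithin (ExitBEC.exitFunction C) (Set.Icc (0 : ℝ) 1) ε := by
  refine ⟨fun δ => δ ^ 2 / 16, fun δ₀ h₀ => ⟨δ₀ ^ 2 / 16, by positivity, fun δ h _ => ?_⟩, ?_⟩
  · exact div_le_div_of_nonneg_right (pow_le_pow_left₀ h₀.le h 2) (by norm_num)
  intro δ hδ hδ' n C hC ε hε hg
  have hder := (ExitBEC.hasDerivAt_exitFunction C ε).hasDerivWithinAt (s := Set.Icc (0 : ℝ) 1)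
  refine ⟨hder.differentiableWithinAt, ?_⟩
  rw [hder.derivWithin (uniqueDiffOn_Icc zero_lt_one ε hε), Finset.mul_sum, Finset.mul_sum]
  refine Finset.sum_le_sum fun i _ => ?_
  have hn : (0 : ℝ) < n := by exact_mod_cast i.pos
  rw [Finset.mul_sum, Finset.mul_sum]
  refine Finset.sum_le_sum fun j hj => ?_
  rw [ExitBEC.exitFunction_eq hC ε i] at hg
  have hpow : (n : ℝ) ^ (3 / 2 : ℝ) = n * √n := by
    rw [Real.sqrt_eq_rpow, ← Real.rpow_one_add' hn.le (by norm_num)]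
    norm_num
  have h := ExitBEC.alpha_mul_le C hε
    (ExitBEC.rankOne_lower_bound C hε hδ hδ' (Finset.ne_of_mem_erase hj).symm hg)
  calc δ ^ 2 / 16 / (n : ℝ) ^ (3 / 2 : ℝ) * ExitBEC.alpha C ε i j
      = 1 / (n : ℝ) * (δ ^ 2 / 16 / √n * ExitBEC.alpha C ε i j) := by
        rw [hpow]
        ring
    _ ≤ _ := mul_le_mul_of_nonneg_left h (by positivity)
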